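/- Let $0<\alpha<1/4$ and let $\sigma_\alpha=\{\alpha+i\tau:\tau\in\mathbb{R}\}\subset\mathbb{C}$, oriented upwards. Let $f,g\in L_2(\mathbb{R}_+;x^{2\alpha-1}dx)$ be complex-valued, where $\mathbb{R}_+=(0,\infty)$, and let $f^*,g^*\in L_2(\sigma_\alpha)$ be their Mellin transforms, $$f^*(s)=\int_0^\infty f(t)\,t^{s-1}\,dt,\quad s\in\sigma_\alpha,$$ and similarly for $g^*$, where the integral is understood in the mean square sense, that is, as the limit of $\int_{1/a}^{a}f(t)\,t^{s-1}\,dt$ in the norm of $L_2(\sigma_\alpha)$ as $a\to\infty$. Suppose that $e^{\pi|s|}f^*(s)$ and $e^{\pi|s|}g^*(s)$ belong to $L_1(\sigma_\alpha)$. If the convolution $$(f*g)(x)=\frac{1}{(2\pi i)^2}\int_{\sigma_\alpha}\int_{\sigma_\alpha}\frac{\cot(\pi s)\cot(\pi w)}{\cot(\pi(s+w))}\,f^*(s)\,g^*(w)\,x^{-s-w}\,ds\,dw$$ vanishes for every $x>0$, then $f=0$ almost everywhere on $\mathbb{R}_+$ or $g=0$ almost everywhere on $\mathbb{R}_+$.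 -/

import Mathlib

/-- The measure `x ^ (2α - 1) dx` on the half-axis `(0, ∞)`. -/
noncomputable def halfAxisMeasure (α : ℝ) : MeasureTheory.Measure ℝ :=
  (MeasureTheory.volume.restrict (Set.Ioi (0 : ℝ))).withDensity
    (fun x => ENNReal.ofReal (x ^ (2 * α - 1)))

/-- The point `α + iτ` of the vertical line `σ_α`. -/
noncomputable def linePoint (α τ : ℝ) : ℂ := (α : ℂ) + (τ : ℂ) * Complex.I

/-- The contour integral `∫_{σ_α} F(s) ds` over the vertical line `σ_α = {α + iτ}`, oriented
upwards, so that `ds = i dτ`. -/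
noncomputable def lineIntegral (α : ℝ) (F : ℂ → ℂ) : ℂ :=
  Complex.I * ∫ τ : ℝ, F (linePoint α τ)

/-- `F` is the Mellin transform of `f ∈ L₂((0, ∞); x ^ (2α - 1) dx)` on the line `σ_α`: the
function `F` is in `L₂(σ_α)`, and the truncated integrals `∫_{1/a}^a f(t) t ^ (s - 1) dt` converge
to `F(s)` in the norm of `L₂(σ_α)` as `a → ∞`. Values of `f` outside `(0, ∞)` and of `F` outside
`σ_α` play no role. -/
structure IsMellinTransform (α : ℝ) (f : ℝ → ℂ) (F : ℂ → ℂ) : Prop where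
  memLp : MeasureTheory.MemLp f 2 (halfAxisMeasure α)
  memLp_line : MeasureTheory.MemLp (fun τ : ℝ => F (linePoint α τ)) 2 MeasureTheory.volume
  tendsto : Filter.Tendsto
    (fun a : ℝ => MeasureTheory.eLpNorm
      (fun τ : ℝ => mellin (Set.indicator (Set.Icc a⁻¹ a) f) (linePoint α τ) - F (linePoint α τ))
      2 MeasureTheory.volume)
    Filter.atTop (nhds 0)

/-- The convolution related to the half-Hilbert transform, as a double Mellin-Barnes integral over
`σ_α × σ_α`, of two functions whose Mellin transforms on `σ_α` are `F` and `G`. -/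
noncomputable def halfHilbertConv (α : ℝ) (F G : ℂ → ℂ) (x : ℝ) : ℂ :=
  1 / (2 * (Real.pi : ℂ) * Complex.I) ^ 2 *
    lineIntegral α (fun w => lineIntegral α (fun s =>
      Complex.cot (Real.pi * s) * Complex.cot (Real.pi * w) / Complex.cot (Real.pi * (s + w)) *
        F s * G w * (x : ℂ) ^ (-s - w)))

/-!
Write `P(τ) = cot(π(α + iτ)) f*(α + iτ)`, let `Q` be the same function for `g`, and put
`T(ξ) = tan(π(2α + iξ))`. At `x = e ^ y` the substitution `ξ = τ + θ` turns the double integral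
into a nonzero factor times the Fourier integral of `T · (P ⋆ Q)` at `y`. As `0 < 2α < 1 / 2`,
the function `T` is bounded, continuous and zero free. Hence uniqueness for Fourier integrals in
`L¹` gives `P ⋆ Q = 0` almost everywhere, and the product of the Fourier integrals of `P` and `Q`
vanishes on `ℝ` (`fourier_mul_fourier_eq_zero`).

The exponential weight in the hypothesis on `f*` and `g*` makes both Fourier integrals analytic in
a strip around `ℝ` (`analyticOnNhd_fourier`), so one of them vanishes identically, say that of
`P`. Then `P = 0` almost everywhere, and so is `f*`, because the cotangent has no zeros on the line.

It remains to see that a function with vanishing Mellin transform is zero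
(`IsMellinTransform.ae_eq_zero`). Plancherel's theorem is avoided: every test function is the
Fourier integral of some `φ ∈ L¹ ∩ L²`, so by Fubini the pairing of `f` with a test function `χ`
supported in `(0, ∞)` equals, for all large `a`, the pairing of `φ` with the truncated Mellin
transform, which tends to zero by the Cauchy–Schwarz inequality.
-/

open MeasureTheory Filter Topology
open scoped ContDiff FourierTransform

/-! ### Fourier integrals -/

/-- Every test function is a Fourier integral, in the normalization `e ^ (-iyx)`, of a function in
`L¹ ∩ L²`; a rescaled inverse Fourier transform in the Schwartz space provides it. -/
theorem exists_fourier_repr {ψ : ℝ → ℂ} (hψ : ContDiff ℝ ∞ ψ) (hs : HasCompactSupport ψ) :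
    ∃ φ : ℝ → ℂ, Integrable φ ∧ MemLp φ 2 ∧
      ∀ x : ℝ, ∫ y : ℝ, φ y * Complex.exp (-((y * x : ℝ) : ℂ) * Complex.I) = ψ x := by
  have hpi : (2 * Real.pi) ≠ 0 := by positivity
  have h1 : ContDiff ℝ ∞ (fun x : ℝ => ψ ((2 * Real.pi) * x)) :=
    hψ.comp (contDiff_const.mul contDiff_id)
  have h2 : HasCompactSupport (fun x : ℝ => ψ ((2 * Real.pi) * x)) :=
    hs.comp_homeomorph (Homeomorph.mulLeft₀ _ hpi)
  set S : SchwartzMap ℝ ℂ := h2.toSchwartzMap h1 with hS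
  refine ⟨(𝓕⁻ S : SchwartzMap ℝ ℂ), (𝓕⁻ S).integrable, (𝓕⁻ S).memLp 2, fun x => ?_⟩
  have h3 : 𝓕 (𝓕⁻ S : SchwartzMap ℝ ℂ) = S := FourierTransform.fourier_fourierInv_eq S
  have h4 : 𝓕 ((𝓕⁻ S : SchwartzMap ℝ ℂ) : ℝ → ℂ) (x / (2 * Real.pi)) = ψ x := by
    rw [← SchwartzMap.fourier_coe, h3]
    change ψ ((2 * Real.pi) * (x / (2 * Real.pi))) = ψ x
    rw [mul_div_cancel₀ _ hpi]
  rw [← h4, Real.fourier_real_eq_integral_exp_smul]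
  refine integral_congr_ae (Eventually.of_forall fun y => ?_)
  simp only [smul_eq_mul]
  rw [mul_comm]
  congr 3
  push_cast
  have : (Real.pi : ℂ) ≠ 0 := by exact_mod_cast Real.pi_ne_zero
  field_simp

theorem integrable_mul_mul_exp {μ : Measure ℝ} [SFinite μ] {P φ : ℝ → ℂ} {k : ℝ → ℝ}
    (hP : Integrable P μ) (hφ : Integrable φ) (hk : Measurable k) :
    Integrable (fun p : ℝ × ℝ => P p.1 * φ p.2 *
      Complex.exp (-((p.2 * k p.1 : ℝ) : ℂ) * Complex.I)) (μ.prod volume) := by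
  refine (hP.mul_prod hφ).mul_bdd (c := 1) ?_ (Eventually.of_forall fun p => ?_)
  · exact Measurable.aestronglyMeasurable (by fun_prop)
  · rw [← Complex.ofReal_neg, Complex.norm_exp_ofReal_mul_I]

/-- Self-adjointness of the Fourier integral, with a measurable phase `k` on one side: the choice
`k t = t` gives the Fourier integral of `P`, and `k t = -log t` its Mellin transform. -/
theorem integral_mul_fourier_swap {μ : Measure ℝ} [SFinite μ] {P φ : ℝ → ℂ} {k : ℝ → ℝ}
    (hP : Integrable P μ) (hφ : Integrable φ) (hk : Measurable k) :
    ∫ t, P t * (∫ y : ℝ, φ y * Complex.exp (-((y * k t : ℝ) : ℂ) * Complex.I)) ∂μ =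
      ∫ y : ℝ, φ y * (∫ t, P t * Complex.exp (-((y * k t : ℝ) : ℂ) * Complex.I) ∂μ) := by
  simp_rw [← integral_const_mul]
  rw [integral_integral_swap]
  · refine integral_congr_ae (Eventually.of_forall fun y => ?_)
    refine integral_congr_ae (Eventually.of_forall fun t => ?_)
    simp only; ring
  · refine (integrable_mul_mul_exp hP hφ hk).congr (Eventually.of_forall fun p => ?_)
    simp only [Function.uncurry]; ring

/-- Uniqueness for Fourier integrals of integrable functions. -/
theorem ae_eq_zero_of_fourier_eq_zero {P : ℝ → ℂ} (hP : Integrable P)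
    (h : ∀ y : ℝ, ∫ τ : ℝ, P τ * Complex.exp (-((y * τ : ℝ) : ℂ) * Complex.I) = 0) :
    P =ᵐ[volume] 0 := by
  refine ae_eq_zero_of_integral_contDiff_smul_eq_zero hP.locallyIntegrable fun g hg hs => ?_
  obtain ⟨φ, hφ, -, hφg⟩ := exists_fourier_repr (ψ := fun x => (g x : ℂ))
    (Complex.ofRealCLM.contDiff.comp hg) (hs.comp_left Complex.ofReal_zero)
  have := integral_mul_fourier_swap hP hφ measurable_id
  simp only [id, h, hφg, mul_zero, integral_zero] at this
  rw [← this]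
  refine integral_congr_ae (Eventually.of_forall fun t => ?_)
  simp only [Complex.real_smul]; ring

/-- Exponential decay makes the Fourier integral real analytic: it extends holomorphically to the
strip `|Im z| < 1`. The rate `π` is more than is needed; any rate at least `2` suffices here. -/
theorem analyticOnNhd_fourier {P : ℝ → ℂ}
    (hP : Integrable (fun τ => (Real.exp (Real.pi * |τ|) : ℂ) * P τ))
    (hPm : AEStronglyMeasurable P) :
    AnalyticOnNhd ℝ (fun y : ℝ =>
      ∫ τ : ℝ, P τ * Complex.exp (-((y * τ : ℝ) : ℂ) * Complex.I)) Set.univ := by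
  set Φ : ℂ → ℂ := fun z => ∫ τ : ℝ, P τ * Complex.exp (-(z * τ) * Complex.I) with hΦ
  set U : Set ℂ := {z | |z.im| < 1} with hU
  have hUo : IsOpen U := isOpen_lt (by fun_prop) continuous_const
  -- On the strip `|Im z| < 1`, the integrand and its derivative are dominated by `e ^ (π|τ|) |P|`.
  have hexp : ∀ z ∈ U, ∀ τ : ℝ, ‖Complex.exp (-(z * τ) * Complex.I)‖ ≤ Real.exp |τ| := by
    intro z hz τ
    rw [Complex.norm_exp]
    refine Real.exp_le_exp.2 ?_
    have : (-(z * τ) * Complex.I).re = z.im * τ := by simp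
    rw [this]
    calc z.im * τ ≤ |z.im * τ| := le_abs_self _
      _ = |z.im| * |τ| := abs_mul _ _
      _ ≤ 1 * |τ| := by gcongr; exact le_of_lt hz
      _ = |τ| := one_mul _
  have hle : ∀ τ : ℝ, |τ| * Real.exp |τ| ≤ Real.exp (Real.pi * |τ|) := by
    intro τ
    calc |τ| * Real.exp |τ| ≤ Real.exp |τ| * Real.exp |τ| := by
          gcongr; linarith [Real.add_one_le_exp |τ|]
      _ = Real.exp (2 * |τ|) := by rw [← Real.exp_add]; ring_nf
      _ ≤ _ := by
          gcongr; exact Real.two_le_pi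
  have hle' : ∀ τ : ℝ, Real.exp |τ| ≤ Real.exp (Real.pi * |τ|) := by
    intro τ
    refine Real.exp_le_exp.2 ?_
    nlinarith [Real.two_le_pi, abs_nonneg τ]
  have hd : DifferentiableOn ℂ Φ U := by
    intro z hz
    refine DifferentiableAt.differentiableWithinAt ?_
    refine (hasDerivAt_integral_of_dominated_loc_of_deriv_le
      (F := fun z (τ : ℝ) => P τ * Complex.exp (-(z * τ) * Complex.I))
      (F' := fun z (τ : ℝ) => P τ * (Complex.exp (-(z * τ) * Complex.I) * (-τ * Complex.I)))
      (bound := fun τ => ‖(Real.exp (Real.pi * |τ|) : ℂ) * P τ‖) (hUo.mem_nhds hz)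
      (Eventually.of_forall fun w => ?_) ?_ ?_ (Eventually.of_forall fun τ w hw => ?_) hP.norm
      (Eventually.of_forall fun τ w hw => ?_)).2.differentiableAt
    · exact hPm.mul (Continuous.aestronglyMeasurable (by fun_prop))
    · refine hP.mono (hPm.mul (Continuous.aestronglyMeasurable (by fun_prop)))
        (Eventually.of_forall fun τ => ?_)
      rw [norm_mul, norm_mul, Complex.norm_real, Real.norm_eq_abs, Real.abs_exp, mul_comm]
      gcongr
      exact (hexp z hz τ).trans (hle' τ)
    · exact hPm.mul (Continuous.aestronglyMeasurable (by fun_prop))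
    · simp only [norm_mul, Complex.norm_real, Real.norm_eq_abs, Real.abs_exp, norm_neg,
        Complex.norm_I, mul_one]
      rw [mul_comm]
      gcongr
      rw [mul_comm]
      exact (mul_le_mul_of_nonneg_left (hexp w hw τ) (abs_nonneg τ)).trans (hle τ)
    · refine HasDerivAt.const_mul _ (HasDerivAt.cexp ?_)
      have := (((hasDerivAt_id w).mul_const (τ : ℂ)).neg).mul_const Complex.I
      simpa using this
  intro y _
  have h1 : AnalyticAt ℂ Φ (y : ℂ) :=
    hd.analyticAt (hUo.mem_nhds (by simp [hU]))
  have h2 : AnalyticAt ℝ (fun y : ℝ => Φ (y : ℂ)) y :=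
    AnalyticAt.fun_comp (g := Φ) h1.restrictScalars (Complex.ofRealCLM.analyticAt y)
  simpa [hΦ] using h2

/-! ### Uniqueness for the Mellin transform -/

/-- On compact subintervals of `(0, ∞)` the weight is bounded above and below, so that `L²` with
the weight is contained in `L¹` without it. -/
theorem IsMellinTransform.integrableOn_Icc {α : ℝ} {f : ℝ → ℂ} {F : ℂ → ℂ}
    (hf : IsMellinTransform α f F) {a b : ℝ} (ha : 0 < a) : IntegrableOn f (Set.Icc a b) := by
  have hsub : Set.Icc a b ⊆ Set.Ioi 0 := fun x hx => lt_of_lt_of_le ha hx.1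
  have hcont : ∀ c : ℝ, ContinuousOn (fun x : ℝ => x ^ c) (Set.Icc a b) := fun c x hx =>
    (Real.continuousAt_rpow_const x c (Or.inl (hsub hx).ne')).continuousWithinAt
  set ν := volume.restrict (Set.Icc a b) with hν
  have hres : (halfAxisMeasure α).restrict (Set.Icc a b) =
      ν.withDensity (fun x => ENNReal.ofReal (x ^ (2 * α - 1))) := by
    rw [halfAxisMeasure, restrict_withDensity measurableSet_Icc,
      Measure.restrict_restrict measurableSet_Icc, Set.inter_eq_left.2 hsub]
  have hL := hf.memLp.restrict (Set.Icc a b)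
  rw [hres] at hL
  have hfin : IsFiniteMeasure (ν.withDensity (fun x => ENNReal.ofReal (x ^ (2 * α - 1)))) := by
    refine isFiniteMeasure_withDensity_ofReal ?_
    exact ((hcont _).integrableOn_Icc).2
  have hI := hL.integrable (by norm_num)
  rw [integrable_withDensity_iff_integrable_smul' (by fun_prop)
    (Eventually.of_forall fun _ => ENNReal.ofReal_lt_top)] at hI
  have hm := IntegrableOn.continuousOn_smul hI (hcont (1 - 2 * α)) isCompact_Icc
  refine IntegrableOn.congr_fun hm (fun x hx => ?_) measurableSet_Icc
  have hx0 : 0 < x := hsub hx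
  rw [ENNReal.toReal_ofReal (by positivity), smul_smul, ← Real.rpow_add hx0]
  simp

/-- Uniqueness for the mean square Mellin transform. -/
theorem IsMellinTransform.ae_eq_zero {α : ℝ} {f : ℝ → ℂ} {F : ℂ → ℂ}
    (hf : IsMellinTransform α f F) (hF : (fun τ : ℝ => F (linePoint α τ)) =ᵐ[volume] 0) :
    ∀ᵐ x ∂(volume.restrict (Set.Ioi (0 : ℝ))), f x = 0 := by
  rw [ae_restrict_iff' measurableSet_Ioi]
  have hloc : LocallyIntegrableOn f (Set.Ioi 0) := by
    rw [locallyIntegrableOn_iff isOpen_Ioi.isLocallyClosed]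
    intro k hk hkc
    rcases k.eq_empty_or_nonempty with rfl | hne
    · simp
    obtain ⟨m, hm, hmin⟩ := hkc.exists_isMinOn hne continuousOn_id
    obtain ⟨M, hM, hmax⟩ := hkc.exists_isMaxOn hne continuousOn_id
    exact (hf.integrableOn_Icc (hk hm)).mono_set fun x hx => ⟨hmin hx, hmax hx⟩
  refine isOpen_Ioi.ae_eq_zero_of_integral_contDiff_smul_eq_zero hloc fun χ hχ hχs hχU => ?_
  -- The test function `χ`, in the variable `x = -log t` and with the weight of the Mellin kernel.
  set ψ : ℝ → ℂ := fun x => ((χ (Real.exp (-x)) * Real.exp (-((1 - α) * x)) : ℝ) : ℂ) with hψ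
  have hψd : ContDiff ℝ ∞ ψ := by
    refine Complex.ofRealCLM.contDiff.comp (ContDiff.mul (hχ.comp ?_) ?_)
    · exact Real.contDiff_exp.comp contDiff_neg
    · exact Real.contDiff_exp.comp ((contDiff_const.mul contDiff_id).neg)
  have hψs : HasCompactSupport ψ := by
    have hK : IsCompact ((fun t => -Real.log t) '' tsupport χ) := by
      refine IsCompact.image_of_continuousOn hχs ?_
      exact (Real.continuousOn_log.mono fun x hx => (hχU hx).ne').neg
    refine HasCompactSupport.of_support_subset_isCompact hK fun x hx => ?_
    refine ⟨Real.exp (-x), subset_tsupport _ ?_, by simp⟩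
    intro h0
    exact hx (by simp [hψ, h0])
  obtain ⟨φ, hφ, hφ2, hφψ⟩ := exists_fourier_repr hψd hψs
  set M : ℝ → ℝ → ℂ := fun a τ => mellin (Set.indicator (Set.Icc a⁻¹ a) f) (linePoint α τ) with hM
  set μ := volume.restrict (Set.Ioi (0 : ℝ)) with hμ
  set P : ℝ → ℝ → ℂ := fun a t =>
    Set.indicator (Set.Icc a⁻¹ a) f t * ((t ^ (α - 1) : ℝ) : ℂ) with hPdef
  have hPint : ∀ a : ℝ, 0 < a → Integrable (P a) μ := by
    intro a ha
    have hc : ContinuousOn (fun x : ℝ => ((x ^ (α - 1) : ℝ) : ℂ)) (Set.Icc a⁻¹ a) := fun x hx =>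
      (Complex.continuous_ofReal.continuousAt.comp (Real.continuousAt_rpow_const x _
        (Or.inl (lt_of_lt_of_le (inv_pos.2 ha) hx.1).ne'))).continuousWithinAt
    have h1 := (hf.integrableOn_Icc (b := a) (inv_pos.2 ha)).mul_continuousOn hc isCompact_Icc
    rw [← integrable_indicator_iff measurableSet_Icc] at h1
    refine (h1.congr (Eventually.of_forall fun t => ?_)).integrableOn
    by_cases ht : t ∈ Set.Icc a⁻¹ a <;> simp [hPdef, ht]
  have hMP : ∀ a τ, M a τ =
      ∫ t, P a t * Complex.exp (-((τ * -Real.log t : ℝ) : ℂ) * Complex.I) ∂μ := by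
    intro a τ
    simp only [hM, mellin]
    refine setIntegral_congr_fun measurableSet_Ioi fun t ht => ?_
    have ht0 : (0 : ℝ) < t := ht
    have htc : (t : ℂ) ≠ 0 := by exact_mod_cast ht0.ne'
    simp only [hPdef, smul_eq_mul]
    rw [mul_comm, mul_assoc]
    congr 1
    rw [Complex.ofReal_cpow ht0.le, Complex.cpow_def_of_ne_zero htc,
      Complex.cpow_def_of_ne_zero htc, ← Complex.exp_add, ← Complex.ofReal_log ht0.le, linePoint]
    congr 1
    push_cast
    ring
  have hMm : ∀ a : ℝ, 0 < a → AEStronglyMeasurable (M a) := by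
    intro a ha
    have : M a = fun τ =>
        ∫ t, P a t * Complex.exp (-((τ * -Real.log t : ℝ) : ℂ) * Complex.I) ∂μ :=
      funext (hMP a)
    rw [this]
    refine AEStronglyMeasurable.integral_prod_right' (μ := volume) (ν := μ)
      (f := fun p : ℝ × ℝ =>
        P a p.2 * Complex.exp (-((p.1 * -Real.log p.2 : ℝ) : ℂ) * Complex.I)) ?_
    exact (hPint a ha).1.comp_snd.mul (Measurable.aestronglyMeasurable (by fun_prop))
  -- As `F` vanishes on the line, the truncated transforms themselves tend to zero in `L²`.
  have htend : Tendsto (fun a => eLpNorm (M a) 2 volume) atTop (𝓝 0) := by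
    refine hf.tendsto.congr fun a => eLpNorm_congr_ae ?_
    filter_upwards [hF] with τ hτ
    simp only [Pi.zero_apply] at hτ
    simp [hM, hτ]
  have htend2 : Tendsto (fun a => ∫ τ, φ τ * M a τ) atTop (𝓝 0) := by
    rw [tendsto_zero_iff_enorm_tendsto_zero]
    have hlim : Tendsto (fun a => eLpNorm φ 2 volume * eLpNorm (M a) 2 volume) atTop (𝓝 0) := by
      simpa using ENNReal.Tendsto.const_mul htend (Or.inr hφ2.2.ne)
    refine tendsto_of_tendsto_of_tendsto_of_le_of_le' tendsto_const_nhds hlim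
      (Eventually.of_forall fun _ => zero_le) ?_
    filter_upwards [eventually_gt_atTop 0] with a ha
    calc ‖∫ τ, φ τ * M a τ‖ₑ ≤ ∫⁻ τ, ‖φ τ * M a τ‖ₑ := enorm_integral_le_lintegral_enorm _
      _ = eLpNorm (φ • M a) 1 volume := by rw [eLpNorm_one_eq_lintegral_enorm]; rfl
      _ ≤ _ := eLpNorm_smul_le_mul_eLpNorm (hMm a ha) hφ.1
  -- Once `[a⁻¹, a]` contains the support of `χ`, the truncation is not seen by `χ`.
  have hev : ∀ᶠ a : ℝ in atTop, ∫ τ, φ τ * M a τ = ∫ t, χ t • f t := by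
    obtain ⟨c, hc0, hc⟩ : ∃ c : ℝ, 0 < c ∧ tsupport χ ⊆ Set.Icc c⁻¹ c := by
      have hK : IsCompact (tsupport χ) := hχs
      obtain ⟨A, hA⟩ := hK.bddAbove
      have hK' : IsCompact ((fun t : ℝ => t⁻¹) '' tsupport χ) :=
        hK.image_of_continuousOn (continuousOn_inv₀.mono fun x hx => (hχU hx).ne')
      obtain ⟨B, hB⟩ := hK'.bddAbove
      refine ⟨max 1 (max A B), by positivity, fun t ht => ⟨?_, ?_⟩⟩
      · have ht0 : 0 < t := hχU ht
        rw [inv_le_comm₀ (by positivity) ht0]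
        exact (hB ⟨t, ht, rfl⟩).trans ((le_max_right A B).trans (le_max_right _ _))
      · exact (hA ht).trans ((le_max_left A B).trans (le_max_right _ _))
    filter_upwards [eventually_ge_atTop c] with a hca
    have ha : 0 < a := hc0.trans_le hca
    have hsw := integral_mul_fourier_swap (k := fun t => -Real.log t) (hPint a ha) hφ (by fun_prop)
    simp_rw [hMP, ← hsw, hφψ]
    rw [hμ, ← integral_indicator measurableSet_Ioi]
    refine integral_congr_ae (Eventually.of_forall fun t => ?_)
    by_cases ht : t ∈ tsupport χ
    · have ht0 : 0 < t := hχU ht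
      have htI : t ∈ Set.Icc a⁻¹ a :=
        ⟨(inv_anti₀ hc0 hca).trans (hc ht).1, (hc ht).2.trans hca⟩
      have hw : t ^ (α - 1) * Real.exp (-((1 - α) * -Real.log t)) = 1 := by
        rw [Real.rpow_def_of_pos ht0, ← Real.exp_add]
        convert Real.exp_zero using 2
        ring
      have hexpt : Real.exp (-(-Real.log t)) = t := by rw [neg_neg, Real.exp_log ht0]
      simp only [Set.indicator_of_mem (show t ∈ Set.Ioi 0 from ht0), hPdef,
        Set.indicator_of_mem htI, hψ, hexpt, Complex.real_smul]
      calc _ = (χ t : ℂ) * f t *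
            ((t ^ (α - 1) * Real.exp (-((1 - α) * -Real.log t)) : ℝ) : ℂ) := by
            push_cast; ring
        _ = _ := by rw [hw]; simp
    · have h0 : χ t = 0 := image_eq_zero_of_notMem_tsupport ht
      by_cases ht0 : t ∈ Set.Ioi (0 : ℝ)
      · have ht0' : 0 < t := ht0
        simp [hψ, Real.exp_log ht0', h0]
      · simp [ht0, h0]
  exact tendsto_nhds_unique (tendsto_const_nhds.congr' (hev.mono fun _ h => h.symm)) htend2

/-! ### The cotangent on vertical lines -/

/-- With `z = x + iy`, both sides are explicit: `|sin z|² = sin² x + sinh² y` and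
`|cos z|² = cos² x + sinh² y`. This bounds the tangent on vertical lines. -/
theorem norm_sin_mul_abs_cos_re_le (z : ℂ) :
    ‖Complex.sin z‖ * |Real.cos z.re| ≤ ‖Complex.cos z‖ := by
  refine abs_le_of_sq_le_sq' ?_ (norm_nonneg _) |>.2
  rw [mul_pow, sq_abs, Complex.sq_norm, Complex.sq_norm, Complex.sin_eq z,
    Complex.cos_eq z,
    ← Complex.ofReal_sin, ← Complex.ofReal_cos, ← Complex.ofReal_sinh, ← Complex.ofReal_cosh]
  have h1 := Real.sin_sq_add_cos_sq z.re
  have h2 := Real.cosh_sq z.im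
  simp only [Complex.normSq_apply, Complex.add_re, Complex.sub_re, Complex.add_im, Complex.sub_im,
    Complex.re_ofReal_mul, Complex.im_ofReal_mul, Complex.mul_I_re, Complex.mul_I_im,
    Complex.ofReal_re, Complex.ofReal_im]
  generalize Real.cos z.re = c at *
  generalize Real.sin z.re = s at *
  generalize Real.cosh z.im = C at *
  generalize Real.sinh z.im = S at *
  have h3 : s ^ 2 = 1 - c ^ 2 := by linarith
  have h4 : (s * C) ^ 2 + (c * S) ^ 2 = 1 - c ^ 2 + S ^ 2 := by
    rw [mul_pow, mul_pow, h3, h2]; ring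
  have h5 : (c * C) ^ 2 + (s * S) ^ 2 = c ^ 2 + S ^ 2 := by
    rw [mul_pow, mul_pow, h3, h2]; ring
  have h6 : 0 ≤ s ^ 2 * S ^ 2 + (c ^ 2) ^ 2 := by positivity
  rw [h3] at h6
  nlinarith [h4, h5, h6, congrArg (· * c ^ 2) h4]

theorem norm_cos_mul_abs_sin_re_le (z : ℂ) :
    ‖Complex.cos z‖ * |Real.sin z.re| ≤ ‖Complex.sin z‖ := by
  have h := norm_sin_mul_abs_cos_re_le ((Real.pi / 2 : ℝ) - z)
  have hre : (((Real.pi / 2 : ℝ) : ℂ) - z).re = Real.pi / 2 - z.re := by simp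
  rw [hre, Real.cos_pi_div_two_sub] at h
  push_cast at h
  rwa [Complex.sin_pi_div_two_sub, Complex.cos_pi_div_two_sub] at h

theorem sin_ne_zero_of_sin_re_ne_zero {z : ℂ} (h : Real.sin z.re ≠ 0) : Complex.sin z ≠ 0 := by
  intro h0
  have h1 := norm_cos_mul_abs_sin_re_le z
  rw [h0, norm_zero] at h1
  have h2 : ‖Complex.cos z‖ = 0 := by
    by_contra h3
    have := mul_pos ((norm_nonneg (Complex.cos z)).lt_of_ne' h3) (abs_pos.2 h)
    linarith
  have := Complex.sin_sq_add_cos_sq z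
  simp [h0, norm_eq_zero.1 h2] at this

theorem cos_ne_zero_of_cos_re_ne_zero {z : ℂ} (h : Real.cos z.re ≠ 0) : Complex.cos z ≠ 0 := by
  rw [← Complex.sin_pi_div_two_sub]
  refine sin_ne_zero_of_sin_re_ne_zero ?_
  have : ((Real.pi : ℂ) / 2 - z).re = Real.pi / 2 - z.re := by
    rw [Complex.sub_re, ← Complex.ofReal_ofNat, ← Complex.ofReal_div, Complex.ofReal_re]
  rwa [this, Real.sin_pi_div_two_sub]

theorem re_pi_mul_linePoint (α τ : ℝ) : ((Real.pi : ℂ) * linePoint α τ).re = Real.pi * α := by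
  simp [linePoint]

theorem continuous_linePoint (α : ℝ) : Continuous (linePoint α) := by
  unfold linePoint; fun_prop

theorem cot_linePoint_ne_zero {α : ℝ} (h0 : 0 < α) (h1 : α < 1 / 2) (τ : ℝ) :
    Complex.cot (Real.pi * linePoint α τ) ≠ 0 := by
  have hpi := Real.pi_pos
  refine div_ne_zero (cos_ne_zero_of_cos_re_ne_zero ?_) (sin_ne_zero_of_sin_re_ne_zero ?_) <;>
    rw [re_pi_mul_linePoint]
  · exact (Real.cos_pos_of_mem_Ioo ⟨by nlinarith, by nlinarith⟩).ne'
  · exact (Real.sin_pos_of_pos_of_lt_pi (by positivity) (by nlinarith)).ne'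

theorem continuous_cot_linePoint {α : ℝ} (h0 : 0 < α) (h1 : α < 1) :
    Continuous (fun τ => Complex.cot (Real.pi * linePoint α τ)) := by
  have hc := continuous_linePoint α
  refine Continuous.div (Complex.continuous_cos.comp (by fun_prop))
    (Complex.continuous_sin.comp (by fun_prop)) fun τ => sin_ne_zero_of_sin_re_ne_zero ?_
  rw [re_pi_mul_linePoint]
  exact (Real.sin_pos_of_pos_of_lt_pi (by positivity) (by nlinarith [Real.pi_pos])).ne'

theorem norm_cot_linePoint_le {α : ℝ} (h0 : 0 < α) (h1 : α < 1) (τ : ℝ) :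
    ‖Complex.cot (Real.pi * linePoint α τ)‖ ≤ |Real.sin (Real.pi * α)|⁻¹ := by
  have hs : 0 < Real.sin (Real.pi * α) :=
    Real.sin_pos_of_pos_of_lt_pi (by positivity) (by nlinarith [Real.pi_pos])
  have h := norm_cos_mul_abs_sin_re_le (Real.pi * linePoint α τ)
  have hne := sin_ne_zero_of_sin_re_ne_zero (z := Real.pi * linePoint α τ)
    (by rw [re_pi_mul_linePoint]; exact hs.ne')
  rw [re_pi_mul_linePoint] at h
  rw [Complex.cot, norm_div, div_le_iff₀ (norm_pos_iff.2 hne), inv_mul_eq_div,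
    le_div_iff₀ (abs_pos.2 hs.ne')]
  exact h

theorem norm_inv_cot_linePoint_le {α : ℝ} (h0 : 0 < α) (h1 : α < 1 / 2) (τ : ℝ) :
    ‖(Complex.cot (Real.pi * linePoint α τ))⁻¹‖ ≤ |Real.cos (Real.pi * α)|⁻¹ := by
  have hpi := Real.pi_pos
  have hs : 0 < Real.cos (Real.pi * α) :=
    Real.cos_pos_of_mem_Ioo ⟨by nlinarith, by nlinarith⟩
  have h := norm_sin_mul_abs_cos_re_le (Real.pi * linePoint α τ)
  have hne := cos_ne_zero_of_cos_re_ne_zero (z := Real.pi * linePoint α τ)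
    (by rw [re_pi_mul_linePoint]; exact hs.ne')
  rw [re_pi_mul_linePoint] at h
  rw [Complex.cot, inv_div, norm_div, div_le_iff₀ (norm_pos_iff.2 hne), inv_mul_eq_div,
    le_div_iff₀ (abs_pos.2 hs.ne')]
  exact h

/-! ### The convolution structure -/

/-- The substitution `ξ = τ + θ`; the inner integral on the right is the convolution of `P` and `Q`. -/
theorem integral_integral_mul_comp_add {m P Q : ℝ → ℂ} {C : ℝ} (hP : Integrable P)
    (hQ : Integrable Q) (hm : Continuous m) (hb : ∀ ξ, ‖m ξ‖ ≤ C) :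
    ∫ θ, ∫ τ, m (τ + θ) * P τ * Q θ = ∫ ξ, m ξ * ∫ θ, Q θ * P (ξ - θ) := by
  have hI : Integrable (fun p : ℝ × ℝ => Q p.2 * P (p.1 - p.2)) (volume.prod volume) :=
    hQ.convolution_integrand (ContinuousLinearMap.mul ℂ ℂ) hP
  have hI' : Integrable (fun p : ℝ × ℝ => m p.1 * (Q p.2 * P (p.1 - p.2)))
      (volume.prod volume) :=
    hI.bdd_mul (c := C) (hm.comp continuous_fst).aestronglyMeasurable
      (Eventually.of_forall fun p => hb p.1)
  simp_rw [← integral_const_mul]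
  rw [integral_integral_swap (f := fun ξ θ => m ξ * (Q θ * P (ξ - θ))) hI']
  refine integral_congr_ae (Eventually.of_forall fun θ => ?_)
  simp only
  rw [← integral_sub_right_eq_self _ θ]
  refine integral_congr_ae (Eventually.of_forall fun ξ => ?_)
  simp only [sub_add_cancel]
  ring

theorem continuous_exp_neg_mul_I (y : ℝ) :
    Continuous (fun ξ : ℝ => Complex.exp (-((y * ξ : ℝ) : ℂ) * Complex.I)) := by fun_prop

theorem norm_exp_neg_mul_I (y ξ : ℝ) :
    ‖Complex.exp (-((y * ξ : ℝ) : ℂ) * Complex.I)‖ = 1 := by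
  rw [← Complex.ofReal_neg, Complex.norm_exp_ofReal_mul_I]

/-- A multiplier `T` without zeros can be removed from a vanishing double Fourier integral: it acts
on the convolution of `P` and `Q`, which therefore vanishes itself. -/
theorem fourier_mul_fourier_eq_zero {T P Q : ℝ → ℂ} {C : ℝ} (hP : Integrable P)
    (hQ : Integrable Q) (hT : Continuous T) (hb : ∀ ξ, ‖T ξ‖ ≤ C) (hT0 : ∀ ξ, T ξ ≠ 0)
    (h : ∀ y : ℝ, ∫ θ, ∫ τ, T (τ + θ) *
      Complex.exp (-((y * (τ + θ) : ℝ) : ℂ) * Complex.I) * P τ * Q θ = 0) (y : ℝ) :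
    (∫ τ, P τ * Complex.exp (-((y * τ : ℝ) : ℂ) * Complex.I)) *
      (∫ τ, Q τ * Complex.exp (-((y * τ : ℝ) : ℂ) * Complex.I)) = 0 := by
  set K : ℝ → ℂ := fun ξ => ∫ θ, Q θ * P (ξ - θ) with hK
  have hKint : Integrable K :=
    (hQ.convolution_integrand (ContinuousLinearMap.mul ℂ ℂ) hP).integral_prod_left
  have hTK : (fun ξ => T ξ * K ξ) =ᵐ[volume] 0 := by
    refine ae_eq_zero_of_fourier_eq_zero
      (hKint.bdd_mul (c := C) hT.aestronglyMeasurable (Eventually.of_forall hb)) fun y => ?_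
    rw [← h y, integral_integral_mul_comp_add (C := C) (m := fun ξ => T ξ *
      Complex.exp (-((y * ξ : ℝ) : ℂ) * Complex.I)) hP hQ (hT.mul (continuous_exp_neg_mul_I y))
      fun ξ => by rw [norm_mul, norm_exp_neg_mul_I, mul_one]; exact hb ξ]
    refine integral_congr_ae (Eventually.of_forall fun ξ => ?_)
    simp only [hK]; ring
  have hK0 : K =ᵐ[volume] 0 := by
    filter_upwards [hTK] with ξ hξ
    exact (mul_eq_zero.1 hξ).resolve_left (hT0 ξ)
  have h1 := integral_integral_mul_comp_add (C := 1)
    (m := fun ξ => Complex.exp (-((y * ξ : ℝ) : ℂ) * Complex.I)) hP hQ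
    (continuous_exp_neg_mul_I y) fun ξ => (norm_exp_neg_mul_I y ξ).le
  have h2 : ∫ ξ : ℝ, Complex.exp (-((y * ξ : ℝ) : ℂ) * Complex.I) * ∫ θ, Q θ * P (ξ - θ) = 0 := by
    rw [integral_eq_zero_of_ae]
    filter_upwards [hK0] with ξ hξ
    simp only [hK, Pi.zero_apply] at hξ
    simp [hξ]
  rw [h2] at h1
  rw [← h1, ← integral_const_mul]
  refine integral_congr_ae (Eventually.of_forall fun θ => ?_)
  simp only
  rw [← integral_mul_const]
  refine integral_congr_ae (Eventually.of_forall fun τ => ?_)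
  simp only
  have : Complex.exp (-((y * (τ + θ) : ℝ) : ℂ) * Complex.I) =
      Complex.exp (-((y * τ : ℝ) : ℂ) * Complex.I) *
        Complex.exp (-((y * θ : ℝ) : ℂ) * Complex.I) := by
    rw [← Complex.exp_add]; congr 1; push_cast; ring
  rw [this]; ring

/-! ### The multiplied transforms -/

/-- The function `τ ↦ cot(π s) F(s)`, `s = α + iτ`. -/
noncomputable def cotMul (α : ℝ) (F : ℂ → ℂ) (τ : ℝ) : ℂ :=
  Complex.cot (Real.pi * linePoint α τ) * F (linePoint α τ)

theorem aestronglyMeasurable_cotMul {α : ℝ} (h0 : 0 < α) (h1 : α < 1) {F : ℂ → ℂ}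
    (hF : AEStronglyMeasurable (fun τ => F (linePoint α τ))) :
    AEStronglyMeasurable (cotMul α F) :=
  (continuous_cot_linePoint h0 h1).aestronglyMeasurable.mul hF

theorem integrable_exp_mul_cotMul {α : ℝ} (h0 : 0 < α) (h1 : α < 1) {F : ℂ → ℂ}
    (hF : AEStronglyMeasurable (fun τ => F (linePoint α τ)))
    (hL1 : Integrable (fun τ : ℝ =>
      (Real.exp (Real.pi * ‖linePoint α τ‖) : ℂ) * F (linePoint α τ))) :
    Integrable (fun τ : ℝ => (Real.exp (Real.pi * |τ|) : ℂ) * cotMul α F τ) := by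
  have hI := hL1.bdd_mul (continuous_cot_linePoint h0 h1).aestronglyMeasurable
    (Eventually.of_forall (norm_cot_linePoint_le h0 h1))
  refine hI.mono (AEStronglyMeasurable.mul (Continuous.aestronglyMeasurable (by fun_prop))
    (aestronglyMeasurable_cotMul h0 h1 hF)) (Eventually.of_forall fun τ => ?_)
  have him : |τ| ≤ ‖linePoint α τ‖ := by
    simpa [linePoint] using Complex.abs_im_le_norm (linePoint α τ)
  simp only [cotMul, norm_mul, Complex.norm_real, Real.norm_eq_abs, Real.abs_exp]
  rw [mul_left_comm]
  gcongr

theorem integrable_cotMul {α : ℝ} (h0 : 0 < α) (h1 : α < 1) {F : ℂ → ℂ}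
    (hF : AEStronglyMeasurable (fun τ => F (linePoint α τ)))
    (hL1 : Integrable (fun τ : ℝ =>
      (Real.exp (Real.pi * ‖linePoint α τ‖) : ℂ) * F (linePoint α τ))) :
    Integrable (cotMul α F) := by
  refine (integrable_exp_mul_cotMul h0 h1 hF hL1).mono (aestronglyMeasurable_cotMul h0 h1 hF)
    (Eventually.of_forall fun τ => ?_)
  rw [norm_mul, Complex.norm_real, Real.norm_eq_abs, Real.abs_exp]
  exact le_mul_of_one_le_left (norm_nonneg _) (Real.one_le_exp (by positivity))

theorem IsMellinTransform.ae_eq_zero_of_fourier_cotMul {α : ℝ} (h0 : 0 < α) (h1 : α < 1 / 2)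
    {f : ℝ → ℂ} {F : ℂ → ℂ} (hf : IsMellinTransform α f F) (hI : Integrable (cotMul α F))
    (h : ∀ y : ℝ, ∫ τ, cotMul α F τ * Complex.exp (-((y * τ : ℝ) : ℂ) * Complex.I) = 0) :
    ∀ᵐ x ∂(volume.restrict (Set.Ioi (0 : ℝ))), f x = 0 := by
  refine hf.ae_eq_zero ?_
  filter_upwards [ae_eq_zero_of_fourier_eq_zero hI h] with τ hτ
  exact (mul_eq_zero.1 hτ).resolve_left (cot_linePoint_ne_zero h0 h1 τ)

/-- The convolution at `x = e ^ y` as a double Fourier integral whose multiplier depends only on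
`τ + θ`. -/
theorem halfHilbertConv_exp (α : ℝ) (F G : ℂ → ℂ) (y : ℝ) :
    halfHilbertConv α F G (Real.exp y) =
      1 / (2 * (Real.pi : ℂ) * Complex.I) ^ 2 * (Complex.I * (Complex.I *
        (Complex.exp (-(2 * α * y : ℝ)) *
        ∫ θ, ∫ τ, (Complex.cot (Real.pi * linePoint (2 * α) (τ + θ)))⁻¹ *
          Complex.exp (-((y * (τ + θ) : ℝ) : ℂ) * Complex.I) * cotMul α F τ * cotMul α G θ))) := by
  simp only [halfHilbertConv, lineIntegral]
  rw [integral_const_mul, ← integral_const_mul (Complex.exp _)]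
  simp_rw [← integral_const_mul (Complex.exp (-((2 * α * y : ℝ) : ℂ)))]
  congr 5
  ext θ
  congr 1
  ext τ
  have hadd : linePoint α τ + linePoint α θ = linePoint (2 * α) (τ + θ) := by
    simp only [linePoint]; push_cast; ring
  have hpow : ((Real.exp y : ℝ) : ℂ) ^ (-linePoint α τ - linePoint α θ) =
      Complex.exp (-((2 * α * y : ℝ) : ℂ)) *
        Complex.exp (-((y * (τ + θ) : ℝ) : ℂ) * Complex.I) := by
    rw [Complex.cpow_def_of_ne_zero (by exact_mod_cast (Real.exp_pos y).ne'),
      ← Complex.ofReal_log (Real.exp_pos y).le, Real.log_exp, ← Complex.exp_add, linePoint,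
      linePoint]
    congr 1
    push_cast
    ring
  rw [hadd, hpow]
  simp only [cotMul]
  ring

theorem theorem4 (α : ℝ) (hα₀ : 0 < α) (hα₁ : α < 1 / 4)
    (f g : ℝ → ℂ) (fStar gStar : ℂ → ℂ)
    (hf : IsMellinTransform α f fStar) (hg : IsMellinTransform α g gStar)
    (hfL1 : MeasureTheory.Integrable (fun τ : ℝ =>
      (Real.exp (Real.pi * ‖linePoint α τ‖) : ℂ) * fStar (linePoint α τ)) MeasureTheory.volume)
    (hgL1 : MeasureTheory.Integrable (fun τ : ℝ =>
      (Real.exp (Real.pi * ‖linePoint α τ‖) : ℂ) * gStar (linePoint α τ)) MeasureTheory.volume)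
    (hconv : ∀ x : ℝ, 0 < x → halfHilbertConv α fStar gStar x = 0) :
    (∀ᵐ x ∂(MeasureTheory.volume.restrict (Set.Ioi (0 : ℝ))), f x = 0) ∨
      (∀ᵐ x ∂(MeasureTheory.volume.restrict (Set.Ioi (0 : ℝ))), g x = 0) := by
  have h1 : α < 1 := by linarith
  have h2 : α < 1 / 2 := by linarith
  have hFm := hf.memLp_line.1
  have hGm := hg.memLp_line.1
  have hP := integrable_cotMul hα₀ h1 hFm hfL1
  have hQ := integrable_cotMul hα₀ h1 hGm hgL1
  have hprod := fourier_mul_fourier_eq_zero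
    (T := fun ξ => (Complex.cot (Real.pi * linePoint (2 * α) ξ))⁻¹) hP hQ
    ((continuous_cot_linePoint (by linarith) (by linarith)).inv₀
      (cot_linePoint_ne_zero (by linarith) (by linarith)))
    (norm_inv_cot_linePoint_le (by linarith) (by linarith))
    (fun ξ => inv_ne_zero (cot_linePoint_ne_zero (by linarith) (by linarith) ξ))
    (fun y => by
      have h := hconv (Real.exp y) (Real.exp_pos y)
      rw [halfHilbertConv_exp] at h
      simpa [Complex.exp_ne_zero, Real.pi_ne_zero] using h)
  have hA := analyticOnNhd_fourier (integrable_exp_mul_cotMul hα₀ h1 hFm hfL1) hP.1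
  have hB := analyticOnNhd_fourier (integrable_exp_mul_cotMul hα₀ h1 hGm hgL1) hQ.1
  refine (AnalyticOnNhd.eq_zero_or_eq_zero_of_mul_eq_zero hA hB (fun y _ => hprod y)
    isPreconnected_univ).imp (fun h => ?_) fun h => ?_
  · exact hf.ae_eq_zero_of_fourier_cotMul hα₀ h2 hP fun y => h y (Set.mem_univ y)
  · exact hg.ae_eq_zero_of_fourier_cotMul hα₀ h2 hQ fun y => h y (Set.mem_univ y)
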